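/- Let $K$ be a field and let $X$ be a finite connected poset with $|X|>1$ (connected means that any two points are joined by a finite sequence of points in which consecutive points are comparable). Let $I(X,K)$ be the incidence algebra of $X$ over $K$, with identity $\delta$, regarded as a Lie algebra under the commutator $[f,g]=fg-gf$. Let $J$ be its Jacobson radical and $Z(J)$ the center of $J$ (the elements of $J$ commuting with all elements of $J$). For $f\in I(X,K)$ write $f=f_D+f_J$, where $f_D$ is the diagonal part of $f$ and $f_J=f-f_D\in J$. For an invertible $\beta$ let $\xi_\beta(f)=\beta f\beta^{-1}$, and for $\sigma\in I(X,K)$ let $M_\sigma(f)(x,y)=\sigma(x,y)f(x,y)$. Call $\sigma$ multiplicative if $\sigma(x,y)\neq 0$ for all $x\le y$ and $\sigma(x,z)=\sigma(x,y)\sigma(y,z)$ for all $x\le y\le z$. A linear map $\varphi$ of $I(X,K)$ to itself is a regular Hom-Lie structure if it is bijective, satisfies $\varphi([a,b])=[\varphi(a),\varphi(b)]$ for all $a,b$, and satisfies $$[[a,b],\varphi(c)]+[[b,c],\varphi(a)]+[[c,a],\varphi(b)]=0\qquad\text{for all } a,b,c\in I(X,K).$$ Let $\varphi$ be a Lie automorphism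 of $I(X,K)$. Then $\varphi$ is a regular Hom-Lie structure on $I(X,K)$ if and only if $$\varphi=\xi_\beta\circ M_\sigma+\nu$$ for some invertible $\beta\in I(X,K)$, some $\sigma\in I(X,K)$ and some $K$-linear map $\nu:I(X,K)\to I(X,K)$ such that 1. $\beta_D=\delta$ and $\beta_J\in Z(J)$; 2. $\sigma$ is multiplicative, and $\sigma(x,y)=1$ for all $x<y$ unless $x$ is a minimal and $y$ is a maximal element of $X$; 3. all values of $\nu$ lie in the center of $I(X,K)$, and $\nu$ vanishes on $J$. Moreover, such $\beta$, $\sigma$ and $\nu$ are unique. -/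

import Mathlib

attribute [local instance] LieRing.ofAssociativeRing

/-- A poset is connected if any two of its points are joined by a finite sequence of points
in which consecutive points are comparable. -/
def PosetConnected (X : Type*) [PartialOrder X] : Prop :=
  ∀ x y : X, Relation.ReflTransGen (fun a b : X => a ≤ b ∨ b ≤ a) x y

section HomLie

variable {K L : Type*} [CommRing K] [LieRing L] [LieAlgebra K L]

/-- The Hom-Jacobi identity: `φ` is a Hom-Lie structure on the Lie algebra `L`. -/
def IsHomLieStructure (φ : L →ₗ[K] L) : Prop :=
  ∀ a b c : L, ⁅⁅a, b⁆, φ c⁆ + ⁅⁅b, c⁆, φ a⁆ + ⁅⁅c, a⁆, φ b⁆ = 0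

/-- A Hom-Lie structure is regular if it is an isomorphism of the Lie algebra `L`. -/
structure IsRegularHomLieStructure (φ : L →ₗ[K] L) : Prop where
  homLie : IsHomLieStructure φ
  map_lie : ∀ a b : L, φ ⁅a, b⁆ = ⁅φ a, φ b⁆
  bijective : Function.Bijective φ

end HomLie

/-- The centre `Z(J)` of the Jacobson radical `J` of a ring `A`: the elements of `J` that
commute with every element of `J`. -/
def jacobsonCenter (A : Type*) [Ring A] : Set A :=
  {r | r ∈ Ring.jacobson A ∧ ∀ s ∈ Ring.jacobson A, r * s = s * r}

/-- The inner automorphism `ξ_β : f ↦ β f β⁻¹`, as a linear map. -/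
def innerMap (K : Type*) {A : Type*} [CommRing K] [Ring A] [Algebra K A] (β : Aˣ) :
    A →ₗ[K] A where
  toFun f := ↑β * f * ↑β⁻¹
  map_add' f g := by rw [mul_add, add_mul]
  map_smul' c f := by simp

namespace IncidenceAlgebra

section

variable {K X : Type*} [Field K] [PartialOrder X]

/-- The diagonal part `f_D` of `f`. -/
def diagPart [DecidableEq X] (f : IncidenceAlgebra K X) : IncidenceAlgebra K X where
  toFun x y := if x = y then f x y else 0
  eq_zero_of_not_le' _ _ h := if_neg fun e => h e.le

/-- The off-diagonal part `f_J = f - f_D` of `f`. -/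
def radPart [DecidableEq X] (f : IncidenceAlgebra K X) : IncidenceAlgebra K X :=
  f - diagPart f

/-- Multiplicative elements of the incidence algebra. -/
structure IsMultiplicative (σ : IncidenceAlgebra K X) : Prop where
  ne_zero : ∀ x y : X, x ≤ y → σ x y ≠ 0
  mul : ∀ x y z : X, x ≤ y → y ≤ z → σ x z = σ x y * σ y z

variable [LocallyFiniteOrder X] [DecidableEq X]

/-- The linear map `M_σ : f ↦ σ ∗ f`, where `∗` is the Hadamard (entrywise) product. -/
def hadamardMap (σ : IncidenceAlgebra K X) : IncidenceAlgebra K X →ₗ[K] IncidenceAlgebra K X where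
  toFun f :=
    { toFun := fun x y => σ x y * f x y
      eq_zero_of_not_le' := fun _ _ h => by rw [apply_eq_zero_of_not_le h f, mul_zero] }
  map_add' f g := by
    ext x y _
    exact mul_add _ _ _
  map_smul' c f := by
    ext x y _
    exact mul_left_comm _ _ _

/-- `φ = ξ_β ∘ M_σ + ν`, where
* `β_D = δ` and `β_J` lies in the centre of the Jacobson radical `J` of the incidence algebra;
* `σ` is multiplicative and `σ(x,y) = 1` for `x < y` unless `x` is minimal and `y` is maximal;
* `ν` is a linear map with central values that annihilates `J`. -/
structure IsInnerMulCentralSum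
    (φ : IncidenceAlgebra K X →ₗ[K] IncidenceAlgebra K X)
    (β : (IncidenceAlgebra K X)ˣ) (σ : IncidenceAlgebra K X)
    (ν : IncidenceAlgebra K X →ₗ[K] IncidenceAlgebra K X) : Prop where
  eq : φ = innerMap K β ∘ₗ hadamardMap σ + ν
  diag : diagPart (β : IncidenceAlgebra K X) = 1
  rad : radPart (β : IncidenceAlgebra K X) ∈ jacobsonCenter (IncidenceAlgebra K X)
  multiplicative : IsMultiplicative σ
  eq_one : ∀ x y : X, x < y → ¬ (IsMin x ∧ IsMax y) → σ x y = 1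
  central : ∀ f, ν f ∈ Subalgebra.center K (IncidenceAlgebra K X)
  annihilates : ∀ f ∈ Ring.jacobson (IncidenceAlgebra K X), ν f = 0

end

end IncidenceAlgebra

/-! Write e_{xy} for the matrix units and e_t = e_{tt}. If φ has the stated form with r = β_J, then
r f r = 0 for every f, so ξ_β(f) = f + rf - fr. Hence φ(c) - c - ν(c) lies in Z(J). Commutators lie
in J, so [[a,b],φ(c)] = [[a,b],c] and Hom-Jacobi becomes Jacobi. Evaluating φ on e_y and e_{xy} at
the entry (x,y), where central values vanish, recovers r and σ; then ν is forced.

Conversely, Hom-Jacobi on (e_t, e_u, e_{uv}) with t ≠ u, v shows that φ(e_t) commutes with e_{uv}.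
So ad φ(e_q) ∘ ad φ(e_p) kills every e_{uv} with u < v except e_{pq}, while it sends φ(e_{pq}) to
-φ(e_{pq}); this determines φ(e_{pq}) up to a nonzero scalar (`map_unit_eq`). Comparing diagonals,
and using connectedness, φ(e_t) has the diagonal of e_t plus a constant. Since the φ(e_t) commute,
their off-diagonal parts are governed by a single r in Z(J) (`map_unit_apply_eq_zero`,
`map_unit_diag_apply`). It follows that φ scales each e_{pq} (`map_unit_eq_smul`); the scalars are
multiplicative, and a second use of Hom-Jacobi makes them 1 away from minimal-maximal pairs
(`map_unit_apply_eq_one`). -/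

namespace IncidenceAlgebra

set_option linter.unusedSectionVars false

/-! ### Matrix units and their brackets. -/

section MatrixUnits

variable {K X : Type*} [Field K] [PartialOrder X] [DecidableEq X]

/-- The matrix unit of the incidence algebra supported at the interval `[p, q]`. -/
def unit {p q : X} (h : p ≤ q) : IncidenceAlgebra K X where
  toFun x y := if x = p ∧ y = q then 1 else 0
  eq_zero_of_not_le' x y h' := by
    rw [if_neg]
    rintro ⟨rfl, rfl⟩
    exact h' h

lemma unit_apply {p q : X} (h : p ≤ q) (x y : X) :
    (unit h : IncidenceAlgebra K X) x y = if x = p ∧ y = q then 1 else 0 := rfl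

lemma unit_le_refl_apply_self (t x : X) :
    (unit (le_refl t) : IncidenceAlgebra K X) x x = if x = t then 1 else 0 := by
  simp [unit_apply]

lemma sum_smul_unit [Fintype {i : X × X // i.1 ≤ i.2}] (f : IncidenceAlgebra K X) :
    ∑ i : {i : X × X // i.1 ≤ i.2}, f i.1.1 i.1.2 • unit i.2 = f := by
  classical
  let ev (x y : X) : IncidenceAlgebra K X →+ K :=
    { toFun := fun g => g x y, map_zero' := rfl, map_add' := fun _ _ => rfl }
  ext x y hxy
  change ev x y _ = _
  rw [map_sum, Finset.sum_eq_single ⟨(x, y), hxy⟩]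
  · simp [ev, constSMul_apply, unit_apply]
  · rintro ⟨⟨u, v⟩, h⟩ - hne
    have : ¬ (x = u ∧ y = v) := by
      rintro ⟨rfl, rfl⟩
      exact hne rfl
    simp [ev, constSMul_apply, unit_apply, this]
  · simp

/-- A linear map that kills the matrix units at pairs `u < v` kills the elements with zero
diagonal. -/
lemma map_eq_zero_of_diag_eq_zero [Finite X] {M : Type*} [AddCommGroup M] [Module K M]
    (T : IncidenceAlgebra K X →ₗ[K] M) (hT : ∀ (u v : X) (h : u < v), T (unit h.le) = 0)
    {f : IncidenceAlgebra K X} (hf : ∀ x, f x x = 0) : T f = 0 := by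
  cases nonempty_fintype {i : X × X // i.1 ≤ i.2}
  rw [← sum_smul_unit f, map_sum]
  refine Finset.sum_eq_zero ?_
  rintro ⟨⟨u, v⟩, h⟩ -
  rcases h.eq_or_lt with e | hlt
  · simp only at e
    subst e
    simp [hf]
  · rw [map_smul, hT u v hlt, smul_zero]

variable [LocallyFiniteOrder X]

lemma mul_apply_self (f g : IncidenceAlgebra K X) (x : X) : (f * g) x x = f x x * g x x := by
  simp

/-- A product entry whose sum has at most one nonzero term. -/
lemma mul_apply_eq_single (f g : IncidenceAlgebra K X) (x y z : X)
    (h : ∀ w, x ≤ w → w ≤ y → w ≠ z → f x w * g w y = 0) :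
    (f * g) x y = f x z * g z y := by
  rw [mul_apply]
  refine Finset.sum_eq_single z (fun w hw hne => ?_) fun hz => ?_
  · rw [Finset.mem_Icc] at hw
    exact h w hw.1 hw.2 hne
  · rw [Finset.mem_Icc, not_and_or] at hz
    rcases hz with hz | hz
    · rw [apply_eq_zero_of_not_le hz, zero_mul]
    · rw [apply_eq_zero_of_not_le hz, mul_zero]

lemma unit_mul_apply {p q : X} (h : p ≤ q) (f : IncidenceAlgebra K X) (x y : X) :
    (unit h * f : IncidenceAlgebra K X) x y = if x = p then f q y else 0 := by
  rw [mul_apply_eq_single _ _ x y q]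
  · simp [unit_apply]
  · intro w _ _ hw
    simp [unit_apply, hw]

lemma mul_unit_apply {p q : X} (h : p ≤ q) (f : IncidenceAlgebra K X) (x y : X) :
    (f * unit h : IncidenceAlgebra K X) x y = if y = q then f x p else 0 := by
  rw [mul_apply_eq_single _ _ x y p]
  · simp [unit_apply]
  · intro w _ _ hw
    simp [unit_apply, hw]

lemma lie_unit_apply {p q : X} (h : p ≤ q) (f : IncidenceAlgebra K X) (x y : X) :
    ⁅f, (unit h : IncidenceAlgebra K X)⁆ x y =
      (if y = q then f x p else 0) - (if x = p then f q y else 0) := by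
  rw [Ring.lie_def, sub_apply, mul_unit_apply, unit_mul_apply]

lemma unit_mul_unit {p q r : X} (h : p ≤ q) (h' : q ≤ r) :
    (unit h * unit h' : IncidenceAlgebra K X) = unit (h.trans h') := by
  ext x y _
  rw [unit_mul_apply, unit_apply, unit_apply]
  by_cases hx : x = p <;> simp [hx]

lemma unit_mul_unit_of_ne {p q r s : X} (h : p ≤ q) (h' : r ≤ s) (hne : q ≠ r) :
    (unit h * unit h' : IncidenceAlgebra K X) = 0 := by
  ext x y _
  rw [unit_mul_apply, unit_apply]
  simp [hne]

lemma lie_unit_diag (t : X) {u v : X} (h : u < v) :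
    ⁅(unit (le_refl t) : IncidenceAlgebra K X), (unit h.le : IncidenceAlgebra K X)⁆ =
      ((if t = u then 1 else 0) - (if t = v then 1 else 0) : K) • unit h.le := by
  have := h.ne
  ext x y _
  rw [lie_unit_apply, constSMul_apply, unit_apply, unit_apply, unit_apply]
  by_cases hx : x = u <;> by_cases hy : y = v <;> by_cases h1 : t = u <;> by_cases h2 : t = v <;>
    simp_all [eq_comm]

lemma lie_unit_left {u v : X} (h : u < v) :
    ⁅(unit (le_refl u) : IncidenceAlgebra K X), (unit h.le : IncidenceAlgebra K X)⁆ =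
      unit h.le := by
  rw [lie_unit_diag u h]
  simp [h.ne]

lemma lie_unit_right {u v : X} (h : u < v) :
    ⁅(unit (le_refl v) : IncidenceAlgebra K X), (unit h.le : IncidenceAlgebra K X)⁆ =
      -unit h.le := by
  rw [lie_unit_diag v h]
  simp [h.ne']

lemma lie_unit_of_ne {t u v : X} (h : u < v) (hu : t ≠ u) (hv : t ≠ v) :
    ⁅(unit (le_refl t) : IncidenceAlgebra K X), (unit h.le : IncidenceAlgebra K X)⁆ = 0 := by
  rw [lie_unit_diag t h]
  simp [hu, hv]

lemma lie_unit_unit_diag (s t : X) :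
    ⁅(unit (le_refl s) : IncidenceAlgebra K X), (unit (le_refl t) : IncidenceAlgebra K X)⁆ = 0 := by
  rcases eq_or_ne s t with rfl | h
  · exact lie_self _
  · rw [Ring.lie_def, unit_mul_unit_of_ne _ _ h, unit_mul_unit_of_ne _ _ h.symm, sub_zero]

lemma lie_unit_unit {u v w : X} (h : u < v) (h' : v < w) :
    ⁅(unit h.le : IncidenceAlgebra K X), (unit h'.le : IncidenceAlgebra K X)⁆ =
      unit (h.trans h').le := by
  rw [Ring.lie_def, unit_mul_unit h.le h'.le, unit_mul_unit_of_ne _ _ (h.trans h').ne', sub_zero]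

lemma lie_apply_self (f g : IncidenceAlgebra K X) (x : X) : ⁅f, g⁆ x x = 0 := by
  rw [Ring.lie_def, sub_apply, mul_apply_self, mul_apply_self, mul_comm, sub_self]

lemma apply_eq_zero_of_lie_unit_eq_zero_left {f : IncidenceAlgebra K X} {u v : X} (h : u ≤ v)
    (hf : ⁅f, (unit h : IncidenceAlgebra K X)⁆ = 0) {x : X} (hx : x ≠ u) : f x u = 0 := by
  have := lie_unit_apply h f x v
  rw [hf] at this
  simpa [hx, eq_comm] using this

lemma apply_eq_zero_of_lie_unit_eq_zero_right {f : IncidenceAlgebra K X} {u v : X} (h : u ≤ v)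
    (hf : ⁅f, (unit h : IncidenceAlgebra K X)⁆ = 0) {y : X} (hy : y ≠ v) : f v y = 0 := by
  have := lie_unit_apply h f u y
  rw [hf] at this
  simpa [hy, eq_comm] using this

lemma apply_eq_of_lie_unit_eq_zero {f : IncidenceAlgebra K X} {u v : X} (h : u ≤ v)
    (hf : ⁅f, (unit h : IncidenceAlgebra K X)⁆ = 0) : f u u = f v v := by
  have := lie_unit_apply h f u v
  rw [hf] at this
  exact sub_eq_zero.1 (by simpa using this.symm)

end MatrixUnits

/-! ### The Jacobson radical and its centre. -/

section Radical

variable {K X : Type*} [Field K] [PartialOrder X] [Finite X] [DecidableEq X] [LocallyFiniteOrder X]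

lemma finite_of_finite : Module.Finite K (IncidenceAlgebra K X) := by
  let T : IncidenceAlgebra K X →ₗ[K] (X → X → K) :=
    { toFun := fun f => f, map_add' := fun _ _ => rfl, map_smul' := fun _ _ => rfl }
  exact Module.Finite.of_injective T DFunLike.coe_injective

/-- An element with unit diagonal has a left inverse. -/
lemma exists_mul_eq_one {g : IncidenceAlgebra K X} (hg : ∀ x, g x x = 1) : ∃ z, z * g = 1 := by
  have := finite_of_finite (K := K) (X := X)
  -- Right multiplication by a unitriangular g is injective, by induction on the column y; in finite
  -- dimension it is then surjective.
  have inj : Function.Injective (LinearMap.mulRight K g) := by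
    rw [← LinearMap.ker_eq_bot, LinearMap.ker_eq_bot']
    intro f hf
    rw [LinearMap.mulRight_apply] at hf
    suffices ∀ y x, f x y = 0 by
      ext x y _
      exact this y x
    intro y
    induction y using WellFoundedLT.induction with
    | ind y ih =>
      intro x
      have := mul_apply_eq_single f g x y y fun w _ hw hne => by
        rw [ih w (hw.lt_of_ne hne), zero_mul]
      rw [hf, hg, mul_one] at this
      exact this.symm
  exact LinearMap.surjective_of_injective inj 1

lemma mem_jacobson_iff_diag {f : IncidenceAlgebra K X} :
    f ∈ Ring.jacobson (IncidenceAlgebra K X) ↔ ∀ x, f x x = 0 := by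
  rw [← Ideal.jacobson_bot, Ideal.mem_jacobson_iff]
  constructor
  · intro h x
    by_contra hx
    -- With this scalar the diagonal entry at x of z * y * f + z - 1 is -1 for every z.
    obtain ⟨z, hz⟩ := h (-(f x x)⁻¹ • 1)
    have := congrArg (fun g : IncidenceAlgebra K X => g x x) ((Ideal.mem_bot).1 hz)
    simp only [sub_apply, add_apply, mul_apply_self, constSMul_apply, one_apply, if_true,
      zero_apply] at this
    simp [hx] at this
  · intro h y
    obtain ⟨z, hz⟩ := exists_mul_eq_one (g := y * f + 1) fun x => by
      rw [add_apply, mul_apply_self, h, mul_zero, zero_add, one_apply, if_pos rfl]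
    refine ⟨z, (Ideal.mem_bot).2 ?_⟩
    rw [← hz]
    noncomm_ring

/-- The centre of the radical consists of the elements supported at the pairs `x < y` with `x`
minimal and `y` maximal. -/
lemma mem_jacobsonCenter_iff {r : IncidenceAlgebra K X} :
    r ∈ jacobsonCenter (IncidenceAlgebra K X) ↔
      ∀ x y, r x y ≠ 0 → x ≠ y ∧ IsMin x ∧ IsMax y := by
  constructor
  · rintro ⟨hr, hc⟩ x y hxy
    rw [mem_jacobson_iff_diag] at hr
    have hc' : ∀ (u v : X) (h : u < v), ⁅r, (unit h.le : IncidenceAlgebra K X)⁆ = 0 := by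
      intro u v h
      rw [Ring.lie_def, sub_eq_zero]
      refine hc _ (mem_jacobson_iff_diag.2 fun x => ?_)
      rw [unit_apply, if_neg]
      rintro ⟨rfl, rfl⟩
      exact h.ne rfl
    have hne : x ≠ y := by
      rintro rfl
      exact hxy (hr x)
    refine ⟨hne, ?_, ?_⟩
    · by_contra hx
      obtain ⟨w, hw⟩ := not_isMin_iff.1 hx
      exact hxy (apply_eq_zero_of_lie_unit_eq_zero_right hw.le (hc' w x hw) hne.symm)
    · by_contra hy
      obtain ⟨w, hw⟩ := not_isMax_iff.1 hy
      exact hxy (apply_eq_zero_of_lie_unit_eq_zero_left hw.le (hc' y w hw) hne)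
  · intro h
    refine ⟨mem_jacobson_iff_diag.2 fun x => ?_, fun s hs => ?_⟩
    · by_contra hx
      exact (h x x hx).1 rfl
    · rw [mem_jacobson_iff_diag] at hs
      have h1 : r * s = 0 := by
        ext x y _
        rw [mul_apply]
        refine Finset.sum_eq_zero fun z hz => ?_
        rw [Finset.mem_Icc] at hz
        by_cases hr : r x z = 0
        · rw [hr, zero_mul]
        · rw [(h x z hr).2.2.eq_of_le hz.2, hs, mul_zero]
      have h2 : s * r = 0 := by
        ext x y _
        rw [mul_apply]
        refine Finset.sum_eq_zero fun z hz => ?_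
        rw [Finset.mem_Icc] at hz
        by_cases hr : r z y = 0
        · rw [hr, mul_zero]
        · rw [(h z y hr).2.1.eq_of_ge hz.1, hs, zero_mul]
      rw [h1, h2]

end Radical

/-! ### Conjugation by 1 + r with r in Z(J); sufficiency and uniqueness. -/

section InnerMap

variable {K X : Type*} [Field K] [PartialOrder X] [Finite X] [DecidableEq X] [LocallyFiniteOrder X]

lemma diagPart_apply (f : IncidenceAlgebra K X) (x y : X) :
    diagPart f x y = if x = y then f x y else 0 := rfl

lemma radPart_apply (f : IncidenceAlgebra K X) (x y : X) :
    radPart f x y = if x = y then 0 else f x y := by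
  rw [radPart, sub_apply, diagPart_apply]
  split_ifs <;> simp

lemma hadamardMap_apply (σ f : IncidenceAlgebra K X) (x y : X) :
    hadamardMap σ f x y = σ x y * f x y := rfl

lemma IsMultiplicative.apply_self {σ : IncidenceAlgebra K X} (hσ : IsMultiplicative σ) (x : X) :
    σ x x = 1 := by
  have h := hσ.mul x x x le_rfl le_rfl
  exact mul_left_cancel₀ (hσ.ne_zero x x le_rfl) (by rw [← h, mul_one])

section Center

variable {r : IncidenceAlgebra K X}

lemma jacobsonCenter_apply_self (hr : r ∈ jacobsonCenter (IncidenceAlgebra K X)) (x : X) :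
    r x x = 0 := mem_jacobson_iff_diag.1 hr.1 x

/-- Only diagonal entries of f survive: r(x,w) ≠ 0 makes w maximal, so w ≤ y forces w = y. -/
lemma jacobsonCenter_mul_apply (hr : r ∈ jacobsonCenter (IncidenceAlgebra K X))
    (f : IncidenceAlgebra K X) (x y : X) : (r * f) x y = r x y * f y y := by
  refine mul_apply_eq_single _ _ _ _ _ fun w _ hw hne => ?_
  by_cases h : r x w = 0
  · rw [h, zero_mul]
  · exact absurd ((mem_jacobsonCenter_iff.1 hr x w h).2.2.eq_of_le hw) hne

lemma mul_jacobsonCenter_apply (hr : r ∈ jacobsonCenter (IncidenceAlgebra K X))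
    (f : IncidenceAlgebra K X) (x y : X) : (f * r) x y = f x x * r x y := by
  refine mul_apply_eq_single _ _ _ _ _ fun w hw _ hne => ?_
  by_cases h : r w y = 0
  · rw [h, mul_zero]
  · exact absurd ((mem_jacobsonCenter_iff.1 hr w y h).2.1.eq_of_ge hw) hne

lemma jacobsonCenter_mul_mul_eq_zero (hr : r ∈ jacobsonCenter (IncidenceAlgebra K X))
    (f : IncidenceAlgebra K X) : r * f * r = 0 := by
  ext x y _
  rw [mul_jacobsonCenter_apply hr, mul_apply_self, jacobsonCenter_apply_self hr, zero_mul,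
    zero_mul, zero_apply]

/-- The unit `1 + r` for `r` in the centre of the radical. -/
def oneAddUnit (r : IncidenceAlgebra K X) (hr : r ∈ jacobsonCenter (IncidenceAlgebra K X)) :
    (IncidenceAlgebra K X)ˣ where
  val := 1 + r
  inv := 1 - r
  val_inv := by
    have := jacobsonCenter_mul_mul_eq_zero hr 1
    rw [mul_one] at this
    rw [add_mul, mul_sub, mul_sub, this]
    simp
  inv_val := by
    have := jacobsonCenter_mul_mul_eq_zero hr 1
    rw [mul_one] at this
    rw [sub_mul, mul_add, mul_add, this]
    simp

lemma oneAddUnit_apply (hr : r ∈ jacobsonCenter (IncidenceAlgebra K X)) (x y : X) :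
    (oneAddUnit r hr : IncidenceAlgebra K X) x y = (if x = y then 1 else 0) + r x y := by
  rw [oneAddUnit, Units.val_mk, add_apply, one_apply]

lemma diagPart_oneAddUnit (hr : r ∈ jacobsonCenter (IncidenceAlgebra K X)) :
    diagPart (oneAddUnit r hr : IncidenceAlgebra K X) = 1 := by
  ext x y _
  rw [diagPart_apply, oneAddUnit_apply, one_apply]
  split_ifs with h
  · rw [← h, jacobsonCenter_apply_self hr, add_zero]
  · rfl

lemma radPart_oneAddUnit (hr : r ∈ jacobsonCenter (IncidenceAlgebra K X)) :
    radPart (oneAddUnit r hr : IncidenceAlgebra K X) = r := by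
  rw [radPart, diagPart_oneAddUnit, oneAddUnit, Units.val_mk, add_sub_cancel_left]

end Center

lemma eq_oneAddUnit {β : (IncidenceAlgebra K X)ˣ}
    (hd : diagPart (β : IncidenceAlgebra K X) = 1)
    (hr : radPart (β : IncidenceAlgebra K X) ∈ jacobsonCenter (IncidenceAlgebra K X)) :
    β = oneAddUnit _ hr := by
  ext1
  change (β : IncidenceAlgebra K X) = 1 + radPart (β : IncidenceAlgebra K X)
  rw [radPart, hd, add_sub_cancel]

/-- Because r f r = 0, conjugation is affine in r: f + rf - fr. -/
lemma innerMap_oneAddUnit_apply {r : IncidenceAlgebra K X}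
    (hr : r ∈ jacobsonCenter (IncidenceAlgebra K X)) (f : IncidenceAlgebra K X) (x y : X) :
    innerMap K (oneAddUnit r hr) f x y = f x y + r x y * (f y y - f x x) := by
  have h : innerMap K (oneAddUnit r hr) f = f + r * f - f * r := by
    change (1 + r) * f * (1 - r) = _
    have := jacobsonCenter_mul_mul_eq_zero hr f
    rw [mul_sub, add_mul, add_mul, add_mul (1 * f), this]
    simp
  rw [h, sub_apply, add_apply, jacobsonCenter_mul_apply hr, mul_jacobsonCenter_apply hr]
  ring

lemma apply_eq_zero_of_mem_center {f : IncidenceAlgebra K X}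
    (hf : f ∈ Subalgebra.center K (IncidenceAlgebra K X)) {x y : X} (hxy : x ≠ y) : f x y = 0 := by
  refine apply_eq_zero_of_lie_unit_eq_zero_right (le_refl x) ?_ hxy.symm
  rw [Ring.lie_def, Subalgebra.mem_center_iff.1 hf, sub_self]

namespace IsInnerMulCentralSum

variable {φ ν : IncidenceAlgebra K X →ₗ[K] IncidenceAlgebra K X} {β : (IncidenceAlgebra K X)ˣ}
  {σ : IncidenceAlgebra K X}

lemma map_apply (h : IsInnerMulCentralSum φ β σ ν) (f : IncidenceAlgebra K X) (x y : X) :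
    φ f x y = σ x y * f x y + radPart (β : IncidenceAlgebra K X) x y * (f y y - f x x) +
      ν f x y := by
  have h1 : φ f = innerMap K (oneAddUnit _ h.rad) (hadamardMap σ f) + ν f := by
    rw [← eq_oneAddUnit h.diag h.rad]
    exact congrArg (fun T : IncidenceAlgebra K X →ₗ[K] IncidenceAlgebra K X => T f) h.eq
  rw [h1, add_apply, innerMap_oneAddUnit_apply, hadamardMap_apply, hadamardMap_apply,
    hadamardMap_apply, h.multiplicative.apply_self, h.multiplicative.apply_self, one_mul, one_mul]

lemma isHomLieStructure (h : IsInnerMulCentralSum φ β σ ν) : IsHomLieStructure φ := by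
  have key : ∀ a b c : IncidenceAlgebra K X, ⁅⁅a, b⁆, φ c⁆ = ⁅⁅a, b⁆, c⁆ := by
    intro a b c
    -- The (x,y) entry is (σ(x,y) - 1)c(x,y) + r(x,y)(c(y,y) - c(x,x)), and both terms live on pairs
    -- of a minimal and a maximal point.
    have hg : φ c - c - ν c ∈ jacobsonCenter (IncidenceAlgebra K X) := by
      refine mem_jacobsonCenter_iff.2 fun x y hxy => ?_
      rw [sub_apply, sub_apply, h.map_apply] at hxy
      by_cases hr : radPart (β : IncidenceAlgebra K X) x y = 0
      · rw [hr] at hxy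
        have hσ : σ x y ≠ 1 := by
          rintro e
          apply hxy
          rw [e]
          ring
        have hc : c x y ≠ 0 := by
          rintro e
          apply hxy
          rw [e]
          ring
        have hne : x ≠ y := by
          rintro rfl
          exact hσ (h.multiplicative.apply_self x)
        refine ⟨hne, ?_⟩
        by_contra hmm
        exact hσ (h.eq_one x y ((le_of_ne_zero hc).lt_of_ne hne) hmm)
      · exact mem_jacobsonCenter_iff.1 h.rad x y hr
    have h1 : ⁅⁅a, b⁆, φ c - c - ν c⁆ = 0 := by
      rw [Ring.lie_def, sub_eq_zero]
      exact (hg.2 _ (mem_jacobson_iff_diag.2 (lie_apply_self a b))).symm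
    have h2 : ⁅⁅a, b⁆, ν c⁆ = 0 := by
      rw [Ring.lie_def, sub_eq_zero]
      exact Subalgebra.mem_center_iff.1 (h.central c) _
    rw [lie_sub, h2, sub_zero, lie_sub, sub_eq_zero] at h1
    exact h1
  intro a b c
  rw [key, key, key]
  simp only [Ring.lie_def]
  noncomm_ring

lemma unique {β' : (IncidenceAlgebra K X)ˣ} {σ' : IncidenceAlgebra K X}
    {ν' : IncidenceAlgebra K X →ₗ[K] IncidenceAlgebra K X}
    (h : IsInnerMulCentralSum φ β σ ν) (h' : IsInnerMulCentralSum φ β' σ' ν') :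
    β = β' ∧ σ = σ' ∧ ν = ν' := by
  have hr : radPart (β : IncidenceAlgebra K X) = radPart (β' : IncidenceAlgebra K X) := by
    ext x y hxy
    by_cases hne : x = y
    · rw [radPart_apply, radPart_apply, if_pos hne, if_pos hne]
    · have := (h.map_apply (unit (le_refl y)) x y).symm.trans (h'.map_apply _ x y)
      rw [apply_eq_zero_of_mem_center (h.central _) hne,
        apply_eq_zero_of_mem_center (h'.central _) hne] at this
      simpa [unit_apply, hne] using this
  have hβ : β = β' := by
    ext1
    have e := h.diag.trans h'.diag.symm
    rw [radPart, radPart, e] at hr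
    exact sub_left_inj.1 hr
  have hσ : σ = σ' := by
    ext x y hxy
    by_cases hne : x = y
    · rw [← hne, h.multiplicative.apply_self, h'.multiplicative.apply_self]
    · have := (h.map_apply (unit hxy) x y).symm.trans (h'.map_apply _ x y)
      rw [apply_eq_zero_of_mem_center (h.central _) hne,
        apply_eq_zero_of_mem_center (h'.central _) hne] at this
      simpa [unit_apply, hne, Ne.symm hne] using this
  subst hβ hσ
  exact ⟨rfl, rfl, add_left_cancel (h.eq.symm.trans h'.eq)⟩

end IsInnerMulCentralSum

end InnerMap

/-! ### Images of matrix units under a regular Hom-Lie structure. -/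

section HomLie

variable {K X : Type*} [Field K] [PartialOrder X] [DecidableEq X] [LocallyFiniteOrder X]

/-- `f` is supported at the pairs `x ≤ p`, `q ≤ y`. -/
def SupportedAround (p q : X) (f : IncidenceAlgebra K X) : Prop :=
  ∀ x y, f x y ≠ 0 → x ≤ p ∧ q ≤ y

lemma supportedAround_unit {p q : X} (h : p ≤ q) :
    SupportedAround p q (unit h : IncidenceAlgebra K X) := by
  intro x y hxy
  rw [unit_apply] at hxy
  split_ifs at hxy with e
  · exact ⟨e.1.le, e.2.ge⟩
  · exact absurd rfl hxy

lemma SupportedAround.smul {p q : X} {f : IncidenceAlgebra K X} (hf : SupportedAround p q f)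
    (c : K) : SupportedAround p q (c • f) := fun x y hxy =>
  hf x y fun e => hxy (by rw [constSMul_apply, e, smul_zero])

/-- These elements form a two-sided ideal: multiplication only moves x down and y up. -/
lemma SupportedAround.lie {p q : X} {f : IncidenceAlgebra K X} (hf : SupportedAround p q f)
    (g : IncidenceAlgebra K X) : SupportedAround p q ⁅g, f⁆ := by
  intro x y hxy
  rw [Ring.lie_def, sub_apply] at hxy
  by_contra hne
  apply hxy
  have h0 : ∀ z w, x ≤ z → w ≤ y → f z w = 0 := by
    intro z w hz hw
    by_contra hf0
    exact hne ⟨hz.trans (hf z w hf0).1, (hf z w hf0).2.trans hw⟩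
  rw [mul_apply, mul_apply, Finset.sum_eq_zero, Finset.sum_eq_zero, sub_zero]
  · intro z hz
    rw [h0 x z le_rfl (Finset.mem_Icc.1 hz).2, zero_mul]
  · intro z hz
    rw [h0 z y (Finset.mem_Icc.1 hz).1 le_rfl, mul_zero]

/-- The position (p,q) is the innermost corner of the support, so only the diagonal of g reaches it.
-/
lemma SupportedAround.lie_apply {p q : X} {f : IncidenceAlgebra K X}
    (hf : SupportedAround p q f) (g : IncidenceAlgebra K X) :
    ⁅g, f⁆ p q = (g p p - g q q) * f p q := by
  rw [Ring.lie_def, sub_apply, mul_apply_eq_single g f p q p, mul_apply_eq_single f g p q q]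
  · ring
  · intro w _ hw hne
    have : f p w = 0 := by
      by_contra h
      exact hne (hw.antisymm (hf p w h).2)
    rw [this, zero_mul]
  · intro w hw _ hne
    have : f w q = 0 := by
      by_contra h
      exact hne ((hf w q h).1.antisymm hw)
    rw [this, mul_zero]

lemma lie_apply_of_middle_eq_zero {f g : IncidenceAlgebra K X} {x y : X} (hxy : x < y)
    (hf : ∀ z, x < z → z < y → f x z * g z y = 0) (hg : ∀ z, x < z → z < y → g x z * f z y = 0) :
    ⁅f, g⁆ x y = g x y * (f x x - f y y) - f x y * (g x x - g y y) := by
  have key : ∀ {f g : IncidenceAlgebra K X},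
      (∀ z, x < z → z < y → f x z * g z y = 0) →
        (f * g) x y = f x x * g x y + f x y * g y y := by
    intro f g hf
    rw [mul_apply, ← Finset.sum_subset (s₁ := {x, y}), Finset.sum_pair hxy.ne]
    · intro z hz
      rw [Finset.mem_insert, Finset.mem_singleton] at hz
      rcases hz with rfl | rfl
      · exact Finset.left_mem_Icc.2 hxy.le
      · exact Finset.right_mem_Icc.2 hxy.le
    · intro z hz hz'
      rw [Finset.mem_insert, Finset.mem_singleton, not_or] at hz'
      rw [Finset.mem_Icc] at hz
      exact hf z (hz.1.lt_of_ne' hz'.1) (hz.2.lt_of_ne hz'.2)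
  rw [Ring.lie_def, sub_apply, key hf, key hg]
  ring

variable [Finite X] {φ : IncidenceAlgebra K X ≃ₗ⁅K⁆ IncidenceAlgebra K X}
  (hφ : ∀ a b c, ⁅⁅a, b⁆, φ c⁆ + ⁅⁅b, c⁆, φ a⁆ + ⁅⁅c, a⁆, φ b⁆ = 0)

lemma lie_map_unit_diag (φ : IncidenceAlgebra K X ≃ₗ⁅K⁆ IncidenceAlgebra K X) (s t : X) :
    ⁅φ (unit (le_refl s)), φ (unit (le_refl t))⁆ = 0 := by
  rw [← LieEquiv.map_lie, lie_unit_unit_diag, map_zero]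

lemma lie_map_unit_left (φ : IncidenceAlgebra K X ≃ₗ⁅K⁆ IncidenceAlgebra K X) {p q : X}
    (h : p < q) : ⁅φ (unit (le_refl p)), φ (unit h.le)⁆ = φ (unit h.le) := by
  rw [← LieEquiv.map_lie, lie_unit_left h]

lemma lie_map_unit_right (φ : IncidenceAlgebra K X ≃ₗ⁅K⁆ IncidenceAlgebra K X) {p q : X}
    (h : p < q) : ⁅φ (unit (le_refl q)), φ (unit h.le)⁆ = -φ (unit h.le) := by
  rw [← LieEquiv.map_lie, lie_unit_right h, map_neg]

lemma map_unit_apply_self (φ : IncidenceAlgebra K X ≃ₗ⁅K⁆ IncidenceAlgebra K X) {p q : X}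
    (h : p < q) (x : X) : φ (unit h.le) x x = 0 := by
  rw [← lie_map_unit_left φ h, lie_apply_self]

/-- The element of the centre of the radical that defines the inner factor of a regular Hom-Lie
structure. -/
def innerPart (φ : IncidenceAlgebra K X ≃ₗ⁅K⁆ IncidenceAlgebra K X) : IncidenceAlgebra K X where
  toFun x y := if x = y then 0 else φ (unit (le_refl y)) x y
  eq_zero_of_not_le' x y h := by
    rw [apply_eq_zero_of_not_le h, ite_self]

open Classical in
/-- The multiplicative factor of a regular Hom-Lie structure. -/
noncomputable def multiplicativePart (φ : IncidenceAlgebra K X ≃ₗ⁅K⁆ IncidenceAlgebra K X) :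
    IncidenceAlgebra K X where
  toFun x y := if h : x < y then φ (unit h.le) x y else if x = y then 1 else 0
  eq_zero_of_not_le' x y h := by
    rw [dif_neg fun h' => h h'.le, if_neg fun h' => h h'.le]

lemma innerPart_apply_self (φ : IncidenceAlgebra K X ≃ₗ⁅K⁆ IncidenceAlgebra K X) (x : X) :
    innerPart φ x x = 0 := if_pos rfl

lemma innerPart_apply_of_ne (φ : IncidenceAlgebra K X ≃ₗ⁅K⁆ IncidenceAlgebra K X) {x y : X}
    (h : x ≠ y) : innerPart φ x y = φ (unit (le_refl y)) x y := if_neg h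

lemma multiplicativePart_apply_self (φ : IncidenceAlgebra K X ≃ₗ⁅K⁆ IncidenceAlgebra K X)
    (x : X) : multiplicativePart φ x x = 1 :=
  (dif_neg (lt_irrefl x)).trans (if_pos rfl)

lemma multiplicativePart_apply_of_lt (φ : IncidenceAlgebra K X ≃ₗ⁅K⁆ IncidenceAlgebra K X)
    {x y : X} (h : x < y) : multiplicativePart φ x y = φ (unit h.le) x y := dif_pos h

include hφ

lemma lie_map_unit_diag_unit {t u v : X} (h : u < v) (hu : t ≠ u) (hv : t ≠ v) :
    ⁅φ (unit (le_refl t)), (unit h.le : IncidenceAlgebra K X)⁆ = 0 := by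
  -- Only the middle term of Hom-Jacobi survives, as e_t commutes with both e_u and e_{uv}.
  have := hφ (unit (le_refl t)) (unit (le_refl u)) (unit h.le)
  rw [lie_unit_unit_diag, zero_lie, zero_add, lie_unit_left h, ← lie_skew (unit h.le) (unit (le_refl t)),
    lie_unit_of_ne h hu hv, neg_zero, zero_lie, add_zero] at this
  rw [← lie_skew, this, neg_zero]

/-- The double adjoint annihilates every strict matrix unit other than e_{pq}, and φ(e_{pq}), a
commutator, has no diagonal part. -/
lemma map_unit_eq {p q : X} (h : p < q) :
    φ (unit h.le) = -φ (unit h.le) p q •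
      ⁅φ (unit (le_refl q)), ⁅φ (unit (le_refl p)), (unit h.le : IncidenceAlgebra K X)⁆⁆ := by
  set T : IncidenceAlgebra K X →ₗ[K] IncidenceAlgebra K X :=
    LieAlgebra.ad K _ (φ (unit (le_refl q))) ∘ₗ LieAlgebra.ad K _ (φ (unit (le_refl p))) with hT
  have T_apply : ∀ f, T f = ⁅φ (unit (le_refl q)), ⁅φ (unit (le_refl p)), f⁆⁆ := fun f => rfl
  let ev : IncidenceAlgebra K X →ₗ[K] K :=
    { toFun := fun g => g p q, map_add' := fun _ _ => rfl, map_smul' := fun _ _ => rfl }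
  have ev_apply : ∀ f, ev f = f p q := fun f => rfl
  have h0 : (T - ev.smulRight (T (unit h.le))) (φ (unit h.le)) = 0 := by
    refine map_eq_zero_of_diag_eq_zero _ (fun u v huv => ?_) (map_unit_apply_self φ h)
    rw [LinearMap.sub_apply, LinearMap.smulRight_apply, ev_apply, unit_apply]
    by_cases e : p = u ∧ q = v
    · obtain ⟨rfl, rfl⟩ := e
      simp
    · rw [if_neg e, zero_smul, sub_zero, T_apply]
      by_cases hp : p ≠ u ∧ p ≠ v
      · rw [lie_map_unit_diag_unit hφ huv hp.1 hp.2, lie_zero]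
      · have hq : q ≠ u ∧ q ≠ v := by
          rw [← not_or]
          rw [← not_or, not_not] at hp
          rintro (rfl | rfl)
          · rcases hp with rfl | rfl
            · exact h.ne rfl
            · exact lt_asymm h huv
          · rcases hp with rfl | rfl
            · exact e ⟨rfl, rfl⟩
            · exact h.ne rfl
        -- The two adjoints commute because φ(e_q) and φ(e_p) do, so the one for q may act first.
        rw [leibniz_lie, lie_map_unit_diag, zero_lie, zero_add,
          lie_map_unit_diag_unit hφ huv hq.1 hq.2, lie_zero]
  rw [LinearMap.sub_apply, LinearMap.smulRight_apply, ev_apply, sub_eq_zero, T_apply,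
    lie_map_unit_left φ h, lie_map_unit_right φ h, T_apply] at h0
  rw [neg_smul, ← h0, neg_neg]

lemma map_unit_apply_ne_zero {p q : X} (h : p < q) : φ (unit h.le) p q ≠ 0 := by
  intro h0
  have := map_unit_eq hφ h
  rw [h0, neg_zero, zero_smul, map_eq_zero_iff φ φ.injective] at this
  have h1 := congrArg (fun f : IncidenceAlgebra K X => f p q) this
  simp [unit_apply] at h1

lemma supportedAround_map_unit {p q : X} (h : p < q) : SupportedAround p q (φ (unit h.le)) := by
  rw [map_unit_eq hφ h]
  exact (((supportedAround_unit h.le).lie _).lie _).smul _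

/-- Compare the nonzero (p,q) entries in φ(e_{pq}) = [φ(e_p), φ(e_{pq})]. -/
lemma map_unit_diag_left {p q : X} (h : p < q) :
    φ (unit (le_refl p)) p p - φ (unit (le_refl p)) q q = 1 := by
  have := (supportedAround_map_unit hφ h).lie_apply (φ (unit (le_refl p)))
  rw [lie_map_unit_left φ h] at this
  exact mul_right_cancel₀ (map_unit_apply_ne_zero hφ h) (by rw [← this, one_mul])

lemma map_unit_diag_right {p q : X} (h : p < q) :
    φ (unit (le_refl q)) p p - φ (unit (le_refl q)) q q = -1 := by
  have := (supportedAround_map_unit hφ h).lie_apply (φ (unit (le_refl q)))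
  rw [lie_map_unit_right φ h, neg_apply] at this
  exact mul_right_cancel₀ (map_unit_apply_ne_zero hφ h) (by rw [← this, neg_one_mul])

lemma map_unit_diag_sub {x y : X} (h : x < y) (t : X) :
    φ (unit (le_refl t)) x x - φ (unit (le_refl t)) y y =
      (if x = t then 1 else 0) - (if y = t then 1 else 0) := by
  by_cases hx : x = t
  · subst hx
    rw [map_unit_diag_left hφ h, if_pos rfl, if_neg h.ne', sub_zero]
  by_cases hy : y = t
  · subst hy
    rw [map_unit_diag_right hφ h, if_pos rfl, if_neg h.ne, zero_sub]
  rw [if_neg hx, if_neg hy, sub_zero, sub_eq_zero]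
  exact apply_eq_of_lie_unit_eq_zero h.le
    (lie_map_unit_diag_unit hφ h (Ne.symm hx) (Ne.symm hy))

lemma exists_map_unit_diag (hX : PosetConnected X) (t : X) :
    ∃ μ : K, ∀ x, φ (unit (le_refl t)) x x = (if x = t then 1 else 0) + μ := by
  refine ⟨φ (unit (le_refl t)) t t - 1, fun x => ?_⟩
  induction hX t x with
  | refl => simp
  | @tail y z _ hyz ih =>
    rcases eq_or_ne y z with rfl | hne
    · exact ih
    rcases hyz with hyz | hyz
    · linear_combination ih - map_unit_diag_sub hφ (hyz.lt_of_ne hne) t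
    · linear_combination ih + map_unit_diag_sub hφ (hyz.lt_of_ne hne.symm) t

/-- If y is maximal and x is not minimal, commutation with e_{wx} (w < x) and with e_{xz} (x < z <
y) clears enough entries of φ(e_y) that the (x,y) entry of [φ(e_y), φ(e_t)] = 0 is just
-φ(e_t)(x,y). If y is not maximal, φ(e_x) plays the dual role. -/
lemma map_unit_apply_eq_zero {x y : X} (hxy : x < y) (hmm : ¬ (IsMin x ∧ IsMax y)) (t : X) :
    φ (unit (le_refl t)) x y = 0 := by
  have hlie : ∀ s, ⁅φ (unit (le_refl s)), φ (unit (le_refl t))⁆ x y = 0 := fun s => by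
    rw [lie_map_unit_diag, zero_apply]
  by_cases hy : IsMax y
  · obtain ⟨w, hw⟩ := not_isMin_iff.1 fun hx => hmm ⟨hx, hy⟩
    have h0 : ∀ z, x < z → z ≤ y → φ (unit (le_refl y)) x z = 0 := fun z hz _ =>
      apply_eq_zero_of_lie_unit_eq_zero_right hw.le
        (lie_map_unit_diag_unit hφ hw (hw.trans hxy).ne' hxy.ne') hz.ne'
    have h0' : ∀ z, x < z → z < y → φ (unit (le_refl y)) z y = 0 := fun z hz hz' =>
      apply_eq_zero_of_lie_unit_eq_zero_right hz.le
        (lie_map_unit_diag_unit hφ hz hxy.ne' hz'.ne') hz'.ne'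
    have := hlie y
    rw [lie_apply_of_middle_eq_zero hxy (fun z hz hz' => by rw [h0 z hz hz'.le, zero_mul])
      (fun z hz hz' => by rw [h0' z hz hz', mul_zero]), h0 y hxy le_rfl,
      map_unit_diag_right hφ hxy] at this
    simpa using this
  · obtain ⟨w, hw⟩ := not_isMax_iff.1 hy
    have h0 : ∀ z, x ≤ z → z < y → φ (unit (le_refl x)) z y = 0 := fun z _ hz =>
      apply_eq_zero_of_lie_unit_eq_zero_left hw.le
        (lie_map_unit_diag_unit hφ hw hxy.ne (hxy.trans hw).ne) hz.ne
    have h0' : ∀ z, x < z → z < y → φ (unit (le_refl x)) x z = 0 := fun z hz hz' =>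
      apply_eq_zero_of_lie_unit_eq_zero_left hz'.le
        (lie_map_unit_diag_unit hφ hz' hz.ne hxy.ne) hz.ne
    have := hlie x
    rw [lie_apply_of_middle_eq_zero hxy (fun z hz hz' => by rw [h0' z hz hz', zero_mul])
      (fun z hz hz' => by rw [h0 z hz.le hz', mul_zero]), h0 x le_rfl hxy,
      map_unit_diag_left hφ hxy] at this
    simpa using this

/-- This identifies the off-diagonal part of φ(e_t) with [r, e_t], where r is `innerPart φ`. -/
lemma map_unit_diag_apply {x y : X} (hxy : x < y) (t : X) :
    φ (unit (le_refl t)) x y =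
      φ (unit (le_refl y)) x y * ((if y = t then 1 else 0) - (if x = t then 1 else 0)) := by
  have h0 : ∀ s z, x < z → z < y → φ (unit (le_refl s)) x z = 0 := fun s z hz hz' =>
    map_unit_apply_eq_zero hφ hz (fun h => h.2.not_lt hz') s
  have : ⁅φ (unit (le_refl y)), φ (unit (le_refl t))⁆ x y = 0 := by
    rw [lie_map_unit_diag, zero_apply]
  rw [lie_apply_of_middle_eq_zero hxy (fun z hz hz' => by rw [h0 _ z hz hz', zero_mul])
    (fun z hz hz' => by rw [h0 _ z hz hz', zero_mul]), map_unit_diag_right hφ hxy,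
    map_unit_diag_sub hφ hxy t] at this
  linear_combination -this

/-- The image of a diagonal idempotent acts on matrix units as the idempotent does. -/
lemma lie_map_unit_diag_unit_eq {u v : X} (h : u < v) (t : X) :
    ⁅φ (unit (le_refl t)), (unit h.le : IncidenceAlgebra K X)⁆ =
      ((if u = t then 1 else 0) - (if v = t then 1 else 0) : K) • unit h.le := by
  ext x y _
  rw [lie_unit_apply, constSMul_apply, unit_apply, ← map_unit_diag_sub hφ h t]
  -- Since u < v, u is not maximal and v is not minimal, so the off-diagonal part of φ(e_t) does not
  -- meet e_{uv}.
  have h1 : x ≠ u → φ (unit (le_refl t)) x u = 0 := fun hx => by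
    by_cases hxu : x ≤ u
    · exact map_unit_apply_eq_zero hφ (hxu.lt_of_ne hx) (fun e => e.2.not_lt h) t
    · exact apply_eq_zero_of_not_le hxu _
  have h2 : y ≠ v → φ (unit (le_refl t)) v y = 0 := fun hy => by
    by_cases hvy : v ≤ y
    · exact map_unit_apply_eq_zero hφ (hvy.lt_of_ne' hy) (fun e => e.1.not_lt h) t
    · exact apply_eq_zero_of_not_le hvy _
  by_cases hx : x = u <;> by_cases hy : y = v <;> simp [hx, hy, h1, h2]

lemma map_unit_eq_smul {p q : X} (h : p < q) :
    φ (unit h.le) = φ (unit h.le) p q • (unit h.le : IncidenceAlgebra K X) := by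
  conv_lhs => rw [map_unit_eq hφ h]
  rw [lie_map_unit_diag_unit_eq hφ h, if_pos rfl, if_neg h.ne', sub_zero, one_smul,
    lie_map_unit_diag_unit_eq hφ h, if_pos rfl, if_neg h.ne, zero_sub, neg_one_smul,
    neg_smul, smul_neg, neg_neg]

lemma map_unit_apply_mul {x y z : X} (hxy : x < y) (hyz : y < z) :
    φ (unit (hxy.trans hyz).le) x z = φ (unit hxy.le) x y * φ (unit hyz.le) y z := by
  rw [← lie_unit_unit hxy hyz, LieEquiv.map_lie, map_unit_eq_smul hφ hxy, map_unit_eq_smul hφ hyz,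
    smul_lie, lie_smul, lie_unit_unit hxy hyz]
  simp [constSMul_apply, unit_apply]

lemma map_unit_apply_eq_one {x y : X} (hxy : x < y) (hmm : ¬ (IsMin x ∧ IsMax y)) :
    φ (unit hxy.le) x y = 1 := by
  by_cases hy : IsMax y
  · obtain ⟨w, hw⟩ := not_isMin_iff.1 fun hx => hmm ⟨hx, hy⟩
    -- With c the scalar of e_{xy}, the identity reads c e_{wy} - e_{wy} = 0; the other case is
    -- dual, with w above y.
    have := hφ (unit (le_refl w)) (unit hw.le) (unit hxy.le)
    rw [lie_unit_left hw, lie_unit_unit hw hxy, ← lie_skew (unit hxy.le) (unit (le_refl w)),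
      lie_unit_of_ne hxy hw.ne (hw.trans hxy).ne, neg_zero, zero_lie, add_zero,
      map_unit_eq_smul hφ hxy, lie_smul, lie_unit_unit hw hxy, ← lie_skew,
      lie_map_unit_diag_unit_eq hφ (hw.trans hxy)] at this
    have h1 := congrArg (fun f : IncidenceAlgebra K X => f w y) this
    simp [add_apply, neg_apply, constSMul_apply, unit_apply, (hw.trans hxy).ne'] at h1
    linear_combination h1
  · obtain ⟨w, hw⟩ := not_isMax_iff.1 hy
    have := hφ (unit (le_refl w)) (unit hxy.le) (unit hw.le)
    rw [lie_unit_of_ne hxy (hxy.trans hw).ne' hw.ne', zero_lie, zero_add, lie_unit_unit hxy hw,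
      ← lie_skew (unit hw.le) (unit (le_refl w)), lie_unit_right hw, neg_neg,
      map_unit_eq_smul hφ hxy, lie_smul, ← lie_skew (unit hw.le) (unit hxy.le),
      lie_unit_unit hxy hw, ← lie_skew, lie_map_unit_diag_unit_eq hφ (hxy.trans hw)] at this
    have h1 := congrArg (fun f : IncidenceAlgebra K X => f x w) this
    simp [add_apply, neg_apply, constSMul_apply, unit_apply, (hxy.trans hw).ne] at h1
    linear_combination -h1

/-! ### Assembling β, σ and ν. -/

lemma innerPart_mem_jacobsonCenter :
    innerPart φ ∈ jacobsonCenter (IncidenceAlgebra K X) := by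
  refine mem_jacobsonCenter_iff.2 fun x y h => ?_
  have hne : x ≠ y := by
    rintro rfl
    exact h (innerPart_apply_self φ x)
  refine ⟨hne, ?_⟩
  by_contra hmm
  apply h
  rw [innerPart_apply_of_ne φ hne]
  exact map_unit_apply_eq_zero hφ ((le_of_ne_zero h).lt_of_ne hne) hmm y

lemma isMultiplicative_multiplicativePart : IsMultiplicative (multiplicativePart φ) where
  ne_zero x y h := by
    rcases h.eq_or_lt with rfl | h
    · rw [multiplicativePart_apply_self]
      exact one_ne_zero
    · rw [multiplicativePart_apply_of_lt φ h]
      exact map_unit_apply_ne_zero hφ h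
  mul x y z hxy hyz := by
    rcases hxy.eq_or_lt with rfl | hxy
    · rw [multiplicativePart_apply_self, one_mul]
    rcases hyz.eq_or_lt with rfl | hyz
    · rw [multiplicativePart_apply_self, mul_one]
    rw [multiplicativePart_apply_of_lt φ hxy, multiplicativePart_apply_of_lt φ hyz,
      multiplicativePart_apply_of_lt φ (hxy.trans hyz), map_unit_apply_mul hφ hxy hyz]

lemma exists_isInnerMulCentralSum (hX : PosetConnected X) :
    ∃ (β : (IncidenceAlgebra K X)ˣ) (σ : IncidenceAlgebra K X)
      (ν : IncidenceAlgebra K X →ₗ[K] IncidenceAlgebra K X),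
      IsInnerMulCentralSum
        (φ.toLinearEquiv : IncidenceAlgebra K X →ₗ[K] IncidenceAlgebra K X) β σ ν := by
  have hr := innerPart_mem_jacobsonCenter hφ
  have hσ := isMultiplicative_multiplicativePart hφ
  set T : IncidenceAlgebra K X →ₗ[K] IncidenceAlgebra K X :=
    innerMap K (oneAddUnit (innerPart φ) hr) ∘ₗ hadamardMap (multiplicativePart φ) with hT
  set Φ : IncidenceAlgebra K X →ₗ[K] IncidenceAlgebra K X :=
    (φ.toLinearEquiv : IncidenceAlgebra K X →ₗ[K] IncidenceAlgebra K X)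
  have T_apply : ∀ f x y, T f x y =
      multiplicativePart φ x y * f x y + innerPart φ x y * (f y y - f x x) := by
    intro f x y
    rw [hT, LinearMap.comp_apply, innerMap_oneAddUnit_apply, hadamardMap_apply, hadamardMap_apply,
      hadamardMap_apply, hσ.apply_self, hσ.apply_self, one_mul, one_mul]
  have off_diag : ∀ (u v : X) (h : u < v), (Φ - T) (unit h.le) = 0 := by
    intro u v h
    rw [LinearMap.sub_apply, sub_eq_zero]
    change φ (unit h.le) = _
    rw [map_unit_eq_smul hφ h]
    ext x y _
    have hd : ∀ z, (unit h.le : IncidenceAlgebra K X) z z = 0 := by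
      intro z
      rw [unit_apply, if_neg]
      rintro ⟨rfl, rfl⟩
      exact h.ne rfl
    rw [T_apply, hd, hd, sub_zero, mul_zero, add_zero, constSMul_apply, unit_apply]
    by_cases e : x = u ∧ y = v
    · obtain ⟨rfl, rfl⟩ := e
      rw [multiplicativePart_apply_of_lt φ h, smul_eq_mul]
    · rw [if_neg e, smul_zero, mul_zero]
  have diag : ∀ t : X, (Φ - T) (unit (le_refl t)) ∈
      Subalgebra.center K (IncidenceAlgebra K X) := by
    intro t
    obtain ⟨μ, hμ⟩ := exists_map_unit_diag hφ hX t
    -- Conjugation already accounts for the off-diagonal part of φ(e_t), so only the constant μ on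
    -- the diagonal is left.
    have : (Φ - T) (unit (le_refl t)) = μ • 1 := by
      rw [LinearMap.sub_apply]
      change φ (unit (le_refl t)) - _ = _
      ext x y hxy
      rw [sub_apply, T_apply, constSMul_apply, one_apply, unit_apply, unit_le_refl_apply_self,
        unit_le_refl_apply_self]
      rcases hxy.eq_or_lt with rfl | hlt
      · rw [hμ, multiplicativePart_apply_self, if_pos (rfl : x = x), smul_eq_mul]
        simp
      · have : ¬ (x = t ∧ y = t) := by
          rintro ⟨rfl, rfl⟩
          exact hlt.ne rfl
        rw [if_neg this, if_neg hlt.ne, innerPart_apply_of_ne φ hlt.ne,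
          map_unit_diag_apply hφ hlt t, smul_zero]
        ring
    rw [this]
    exact Subalgebra.smul_mem _ (one_mem _) μ
  refine ⟨oneAddUnit (innerPart φ) hr, multiplicativePart φ, Φ - T, ?_, diagPart_oneAddUnit hr,
    by rwa [radPart_oneAddUnit], hσ, ?_, ?_, ?_⟩
  · rw [← hT, add_sub_cancel]
  · intro x y hxy hmm
    rw [multiplicativePart_apply_of_lt φ hxy]
    exact map_unit_apply_eq_one hφ hxy hmm
  · intro f
    cases nonempty_fintype {i : X × X // i.1 ≤ i.2}
    rw [← sum_smul_unit f, map_sum]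
    refine sum_mem ?_
    rintro ⟨⟨u, v⟩, h⟩ -
    rw [map_smul]
    refine Subalgebra.smul_mem _ ?_ _
    rcases h.eq_or_lt with e | hlt
    · simp only at e
      subst e
      exact diag u
    · rw [off_diag u v hlt]
      exact zero_mem _
  · intro f hf
    exact map_eq_zero_of_diag_eq_zero _ off_diag (mem_jacobson_iff_diag.1 hf)

end HomLie

end IncidenceAlgebra

theorem corollary2p12 {K X : Type*} [Field K] [PartialOrder X] [Finite X] [Nontrivial X]
    [LocallyFiniteOrder X] [DecidableEq X] (hX : PosetConnected X)
    (φ : IncidenceAlgebra K X ≃ₗ⁅K⁆ IncidenceAlgebra K X) :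
    (IsRegularHomLieStructure
        (φ.toLinearEquiv : IncidenceAlgebra K X →ₗ[K] IncidenceAlgebra K X) ↔
      ∃ (β : (IncidenceAlgebra K X)ˣ) (σ : IncidenceAlgebra K X)
        (ν : IncidenceAlgebra K X →ₗ[K] IncidenceAlgebra K X),
        IncidenceAlgebra.IsInnerMulCentralSum
          (φ.toLinearEquiv : IncidenceAlgebra K X →ₗ[K] IncidenceAlgebra K X) β σ ν) ∧
    (∀ (β β' : (IncidenceAlgebra K X)ˣ) (σ σ' : IncidenceAlgebra K X)
        (ν ν' : IncidenceAlgebra K X →ₗ[K] IncidenceAlgebra K X),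
        IncidenceAlgebra.IsInnerMulCentralSum
          (φ.toLinearEquiv : IncidenceAlgebra K X →ₗ[K] IncidenceAlgebra K X) β σ ν →
        IncidenceAlgebra.IsInnerMulCentralSum
          (φ.toLinearEquiv : IncidenceAlgebra K X →ₗ[K] IncidenceAlgebra K X) β' σ' ν' →
        β = β' ∧ σ = σ' ∧ ν = ν') := by
  refine ⟨⟨fun h => ?_, ?_⟩, fun β β' σ σ' ν ν' h h' => h.unique h'⟩
  · exact IncidenceAlgebra.exists_isInnerMulCentralSum (fun a b c => h.homLie a b c) hX
  · rintro ⟨β, σ, ν, h⟩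
    exact ⟨h.isHomLieStructure, fun a b => φ.map_lie a b, φ.bijective⟩
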